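/- Theorem (degree eight). There are infinitely many pairwise non-proportional nontrivial solutions in positive integers of $$A_1^8+A_2^8+A_3^8+A_4^8+A_5^8+A_6^8=B_1^8+B_2^8+B_3^8+B_4^8+B_5^8+B_6^8 .$$ More precisely, there are infinitely many pairs $(A,B)$ of $6$-tuples $A=(A_1,\dots,A_6)$, $B=(B_1,\dots,B_6)$ of positive integers such that the displayed equation holds, $A_i\neq B_j$ for all $1\le i,j\le 6$ (no term cancels), and $\gcd(A_1,\dots,A_6,B_1,\dots,B_6)=1$. -/

import Mathlib

/-- `(A, B)` is a solution in positive integers of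
`A₁ ^ 8 + ⋯ + A₆ ^ 8 = B₁ ^ 8 + ⋯ + B₆ ^ 8`. -/
def IsEighthPowerSolution (A B : Fin 6 → ℤ) : Prop :=
  (∀ i, 0 < A i) ∧ (∀ i, 0 < B i) ∧ ∑ i, A i ^ 8 = ∑ i, B i ^ 8

/-- No term of one side occurs on the other side, so that nothing cancels. -/
def IsNontrivialPair (A B : Fin 6 → ℤ) : Prop :=
  ∀ i j, A i ≠ B j

/-- The twelve integers have no common divisor other than `1` and `-1`. -/
def IsPrimitivePair (A B : Fin 6 → ℤ) : Prop :=
  ∀ d : ℤ, (∀ i, d ∣ A i) → (∀ i, d ∣ B i) → IsUnit d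

/-!
The Diophantine equation is solved along a curve of genus one. Whenever integers `s, k, m, t`
satisfy

  `k ^ 2 = s ^ 2 - 96 * t ^ 2`  and  `m ^ 2 = 3 * s ^ 2 - 104 * t ^ 2`,

the six linear forms `8t, m ± 2t, 2s, k ± 6t` and the six linear forms `m ± 6t, s ± k, s ± 6t`
have equal sums of eighth powers (`sum_leftForms_pow_eight`). Both sides are even in `k` and in `m`,
so this is a polynomial identity in `s` and `t` once `k ^ 2` and `m ^ 2` are eliminated.

It remains to find infinitely many suitable points on this curve. It is a torsor under the elliptic
curve cut out by the quadrics `X ^ 2 - Y ^ 2 = 104 * T ^ 2` and `X ^ 2 - Z ^ 2 = 288 * T ^ 2`, with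
origin `(1, 1, 1, 0)`: both curves cover `y ^ 2 = x * (x - 104) * (x - 288)`, the latter by
`x = (X / T) ^ 2` and the former by `x = 3 * (s / t) ^ 2`. In these coordinates duplication and the
torsor action are given by short polynomial formulas. Repeated duplication of the point
`(113, 95, 49, 6)` raises the exact power of `2` dividing `T` by one each time and so tends
`2`-adically to the origin (`exists_jacobi_point`). Letting these points act on the fixed point
`(4430, 4406, 7658, 47)` gives points that tend `2`-adically to it (`exists_torsor_point`).

* All of these points, up to an odd factor, agree with the fixed point modulo `256`, and for the
  fixed point no two opposite terms agree up to sign modulo `256`; so nothing cancels.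
* The `2`-adic distance of `s / t` from its limit can be read off exactly and is strictly
  decreasing, so the ratios `s / t` differ even up to sign (`eq_of_ratio_eq`). This ratio survives
  division by the common factor, so the primitive solutions are pairwise distinct.
-/

/-! ### The linear forms -/

/-- The six linear forms on the left-hand side, before passing to absolute values. -/
def leftForms (s k m t : ℤ) : Fin 6 → ℤ :=
  ![8 * t, 2 * s, m + 2 * t, m - 2 * t, k + 6 * t, k - 6 * t]

/-- The six linear forms on the right-hand side, before passing to absolute values. -/
def rightForms (s k m t : ℤ) : Fin 6 → ℤ :=
  ![m + 6 * t, m - 6 * t, s + k, s - k, s + 6 * t, s - 6 * t]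

theorem sum_leftForms_pow_eight {s k m t : ℤ} (hk : k ^ 2 = s ^ 2 - 96 * t ^ 2)
    (hm : m ^ 2 = 3 * s ^ 2 - 104 * t ^ 2) :
    ∑ i, leftForms s k m t i ^ 8 = ∑ i, rightForms s k m t i ^ 8 := by
  have hk4 : k ^ 4 = (s ^ 2 - 96 * t ^ 2) ^ 2 := by rw [← hk]; ring
  have hk6 : k ^ 6 = (s ^ 2 - 96 * t ^ 2) ^ 3 := by rw [← hk]; ring
  have hm4 : m ^ 4 = (3 * s ^ 2 - 104 * t ^ 2) ^ 2 := by rw [← hm]; ring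
  have hm6 : m ^ 6 = (3 * s ^ 2 - 104 * t ^ 2) ^ 3 := by rw [← hm]; ring
  simp only [Fin.sum_univ_six, leftForms, rightForms, Matrix.cons_val]
  -- the terms `k ^ 8` and `m ^ 8` cancel, which leaves only these six even powers to eliminate
  linear_combination 56 * (4 - 36) * t ^ 2 * hm6 + 140 * (16 - 1296) * t ^ 4 * hm4 +
    56 * (64 - 46656) * t ^ 6 * hm + 56 * (36 * t ^ 2 - s ^ 2) * hk6 +
    140 * (1296 * t ^ 4 - s ^ 4) * hk4 + 56 * (46656 * t ^ 6 - s ^ 6) * hk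

theorem leftForms_modEq {n c s k m t s' k' m' t' : ℤ} (hs : s' ≡ c * s [ZMOD n])
    (hk : k' ≡ c * k [ZMOD n]) (hm : m' ≡ c * m [ZMOD n]) (ht : t' ≡ c * t [ZMOD n]) (i : Fin 6) :
    leftForms s' k' m' t' i ≡ c * leftForms s k m t i [ZMOD n] := by
  have h (a b : ℤ) : c * (a * b) = a * (c * b) := by ring
  fin_cases i <;>
    simp only [leftForms, Fin.reduceFinMk, Fin.zero_eta, Fin.mk_one, Matrix.cons_val, mul_add,
      mul_sub, h] <;>
    first
    | exact ht.mul_left _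
    | exact hs.mul_left _
    | exact hm.add (ht.mul_left _)
    | exact hm.sub (ht.mul_left _)
    | exact hk.add (ht.mul_left _)
    | exact hk.sub (ht.mul_left _)

theorem rightForms_modEq {n c s k m t s' k' m' t' : ℤ} (hs : s' ≡ c * s [ZMOD n])
    (hk : k' ≡ c * k [ZMOD n]) (hm : m' ≡ c * m [ZMOD n]) (ht : t' ≡ c * t [ZMOD n]) (i : Fin 6) :
    rightForms s' k' m' t' i ≡ c * rightForms s k m t i [ZMOD n] := by
  have h (a b : ℤ) : c * (a * b) = a * (c * b) := by ring
  fin_cases i <;>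
    simp only [rightForms, Fin.reduceFinMk, Fin.zero_eta, Fin.mk_one, Matrix.cons_val, mul_add,
      mul_sub, h] <;>
    first
    | exact hm.add (ht.mul_left _)
    | exact hm.sub (ht.mul_left _)
    | exact hs.add hk
    | exact hs.sub hk
    | exact hs.add (ht.mul_left _)
    | exact hs.sub (ht.mul_left _)

/-! ### Points close to the origin -/

/-- The iterated doubles of `(113, 95, 49, 6)`, starting with the first one. The last coordinate
is written as `2 ^ (n + 2) * T` with `T` odd, so that its exact power of `2` is recorded. -/
theorem exists_jacobi_point (n : ℕ) : ∃ X Y Z T : ℤ,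
    Y ^ 2 = X ^ 2 - 104 * (2 ^ (n + 2) * T) ^ 2 ∧ Z ^ 2 = X ^ 2 - 288 * (2 ^ (n + 2) * T) ^ 2 ∧
    Odd X ∧ Odd T ∧ 2 ^ (n + 4) ∣ Y - X ∧ 2 ^ (n + 4) ∣ Z - X := by
  induction n with
  | zero => exact ⟨124229569, 106250881, -62912831, 1578045, by norm_num, by norm_num,
      by decide, by decide, by decide, by decide⟩
  | succ n ih =>
    obtain ⟨X, Y, Z, T, hY, hZ, hX, hT, hXY, hXZ⟩ := ih
    have h2 : (2 : ℤ) ∣ 2 ^ (n + 4) := dvd_pow_self _ (by lia)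
    have hYo : Odd Y := by
      have := hX.add_even (even_iff_two_dvd.mpr (h2.trans hXY)); rwa [add_sub_cancel] at this
    have hZo : Odd Z := by
      have := hX.add_even (even_iff_two_dvd.mpr (h2.trans hXZ)); rwa [add_sub_cancel] at this
    have hpow : (2 : ℤ) ^ (n + 1 + 2) = 2 * 2 ^ (n + 2) := by ring
    -- duplication on the intersection of quadrics, where `29952 = 104 * 288`
    refine ⟨X ^ 4 - 29952 * (2 ^ (n + 2) * T) ^ 4,
      X ^ 4 - 208 * X ^ 2 * (2 ^ (n + 2) * T) ^ 2 + 29952 * (2 ^ (n + 2) * T) ^ 4,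
      X ^ 4 - 576 * X ^ 2 * (2 ^ (n + 2) * T) ^ 2 + 29952 * (2 ^ (n + 2) * T) ^ 4,
      X * Y * Z * T, ?_, ?_, ?_, ((hX.mul hYo).mul hZo).mul hT, ?_, ?_⟩
    · rw [hpow]
      generalize (2 : ℤ) ^ (n + 2) = w at *
      linear_combination 416 * X ^ 2 * (w * T) ^ 2 * Z ^ 2 * hY +
        416 * X ^ 2 * (w * T) ^ 2 * (X ^ 2 - 104 * (w * T) ^ 2) * hZ
    · rw [hpow]
      generalize (2 : ℤ) ^ (n + 2) = w at *
      linear_combination 1152 * X ^ 2 * (w * T) ^ 2 * Z ^ 2 * hY +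
        1152 * X ^ 2 * (w * T) ^ 2 * (X ^ 2 - 104 * (w * T) ^ 2) * hZ
    · exact hX.pow.sub_even ((by decide : Even (29952 : ℤ)).mul_right _)
    · refine ⟨-(2 ^ (n + 3) * 13 * T ^ 2 * Z ^ 2), ?_⟩
      rw [hZ]; ring
    · refine ⟨-(2 ^ (n + 3) * 36 * T ^ 2 * Y ^ 2), ?_⟩
      rw [hY]; ring

/-! ### The action on a fixed point -/

/-- The point `(X, Y, Z, T)` acts on `(s, k, m, t)` by the chord construction on
`y ^ 2 = x * (x - 104) * (x - 288)`. If `x₁`, `x₂`, `x₃` are the abscissae of collinear points and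
`e` is a root of the cubic, then `(x₁ - e) * (x₂ - e) * (x₃ - e)` is the square of the ordinate of
the line at `e`; the new coordinates are read off from the square roots for the three roots `e`.
This is the first of the two equations of the curve, and `torsor_action_snd` is the second. -/
theorem torsor_action_fst {s k m t X Y Z T : ℤ} (hk : k ^ 2 = s ^ 2 - 96 * t ^ 2)
    (hm : m ^ 2 = 3 * s ^ 2 - 104 * t ^ 2) (hY : Y ^ 2 = X ^ 2 - 104 * T ^ 2)
    (hZ : Z ^ 2 = X ^ 2 - 288 * T ^ 2) :
    (k * t * X * Y - s * m * Z * T) ^ 2 =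
      (s * t * Y * Z - k * m * X * T) ^ 2 - 96 * (t ^ 2 * X ^ 2 - 3 * s ^ 2 * T ^ 2) ^ 2 := by
  linear_combination (t ^ 2 * X ^ 2 * Y ^ 2 - m ^ 2 * X ^ 2 * T ^ 2) * hk +
    (s ^ 2 * Z ^ 2 * T ^ 2 - (s ^ 2 - 96 * t ^ 2) * X ^ 2 * T ^ 2) * hm +
    ((s ^ 2 - 96 * t ^ 2) * t ^ 2 * X ^ 2 - s ^ 2 * t ^ 2 * Z ^ 2) * hY +
    (s ^ 2 * (3 * s ^ 2 - 104 * t ^ 2) * T ^ 2 - s ^ 2 * t ^ 2 * (X ^ 2 - 104 * T ^ 2)) * hZ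

theorem torsor_action_snd {s k m t X Y Z T : ℤ} (hk : k ^ 2 = s ^ 2 - 96 * t ^ 2)
    (hm : m ^ 2 = 3 * s ^ 2 - 104 * t ^ 2) (hY : Y ^ 2 = X ^ 2 - 104 * T ^ 2)
    (hZ : Z ^ 2 = X ^ 2 - 288 * T ^ 2) :
    (m * t * X * Z - 3 * s * k * Y * T) ^ 2 =
      3 * (s * t * Y * Z - k * m * X * T) ^ 2 -
        104 * (t ^ 2 * X ^ 2 - 3 * s ^ 2 * T ^ 2) ^ 2 := by
  linear_combination (9 * s ^ 2 * Y ^ 2 * T ^ 2 - 3 * m ^ 2 * X ^ 2 * T ^ 2) * hk +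
    (t ^ 2 * X ^ 2 * Z ^ 2 - 3 * (s ^ 2 - 96 * t ^ 2) * X ^ 2 * T ^ 2) * hm +
    (9 * s ^ 2 * (s ^ 2 - 96 * t ^ 2) * T ^ 2 - 3 * s ^ 2 * t ^ 2 * Z ^ 2) * hY +
    ((3 * s ^ 2 - 104 * t ^ 2) * t ^ 2 * X ^ 2 - 3 * s ^ 2 * t ^ 2 * (X ^ 2 - 104 * T ^ 2)) * hZ

/-- Points that tend `2`-adically to `(4430, 4406, 7658, 47)`. The last condition states the
exact power of `2` dividing the difference of `s / t` and `4430 / 47`. -/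
theorem exists_torsor_point (n : ℕ) : ∃ s k m t c d : ℤ,
    k ^ 2 = s ^ 2 - 96 * t ^ 2 ∧ m ^ 2 = 3 * s ^ 2 - 104 * t ^ 2 ∧ Odd c ∧
    s ≡ c * 4430 [ZMOD 256] ∧ k ≡ c * 4406 [ZMOD 256] ∧ m ≡ c * 7658 [ZMOD 256] ∧
    t ≡ c * 47 [ZMOD 256] ∧ Odd d ∧ s * 47 - 4430 * t = 2 ^ (n + 10) * d := by
  -- the shift by `6` makes the coordinate `2 ^ (n + 8) * T` divisible by `256`
  obtain ⟨X, Y, Z, T, hY, hZ, hX, hT, ⟨y, hy⟩, ⟨z, hz⟩⟩ := exists_jacobi_point (n + 6)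
  have hp : (2 : ℤ) ^ (n + 6 + 2) = 256 * 2 ^ n := by ring
  have hp' : (2 : ℤ) ^ (n + 6 + 4) = 1024 * 2 ^ n := by ring
  have hp'' : (2 : ℤ) ^ (n + 10) = 1024 * 2 ^ n := by ring
  rw [hp] at hY hZ
  rw [hp'] at hy hz
  rw [hp'']
  generalize (2 : ℤ) ^ n = w at *
  have hT0 : 256 * w * T ≡ 0 [ZMOD 256] :=
    Int.modEq_zero_iff_dvd.mpr ⟨w * T, by ring⟩
  have hYX : Y ≡ X [ZMOD 256] :=
    (Int.modEq_iff_dvd.mpr ⟨4 * w * y, by rw [hy]; ring⟩ : X ≡ Y [ZMOD 256]).symm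
  have hZX : Z ≡ X [ZMOD 256] :=
    (Int.modEq_iff_dvd.mpr ⟨4 * w * z, by rw [hz]; ring⟩ : X ≡ Z [ZMOD 256]).symm
  refine ⟨4430 * 47 * Y * Z - 4406 * 7658 * X * (256 * w * T),
    4406 * 47 * X * Y - 4430 * 7658 * Z * (256 * w * T),
    7658 * 47 * X * Z - 3 * 4430 * 4406 * Y * (256 * w * T),
    47 ^ 2 * X ^ 2 - 3 * 4430 ^ 2 * (256 * w * T) ^ 2, 47 * X ^ 2,
    4430 * 47 ^ 2 * (X * y + X * z + 1024 * w * y * z) -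
      T * (47 * 2203 * 3829 * X - 3 * 4430 ^ 3 * 64 * w * T),
    torsor_action_fst (by norm_num) (by norm_num) hY hZ,
    torsor_action_snd (by norm_num) (by norm_num) hY hZ,
    (by decide : Odd (47 : ℤ)).mul hX.pow, ?_, ?_, ?_, ?_, ?_, ?_⟩
  · convert ((hYX.mul_left (4430 * 47)).mul hZX).sub (hT0.mul_left (4406 * 7658 * X)) using 1
    ring
  · convert (hYX.mul_left (4406 * 47 * X)).sub ((hZX.mul_left (4430 * 7658)).mul hT0) using 1
    ring
  · convert (hZX.mul_left (7658 * 47 * X)).sub ((hYX.mul_left (3 * 4430 * 4406)).mul hT0) using 1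
    ring
  · convert (Int.ModEq.refl (47 ^ 2 * X ^ 2)).sub ((hT0.pow 2).mul_left (3 * 4430 ^ 2)) using 1
    ring
  · refine Even.sub_odd ?_ (hT.mul (Odd.sub_even ((by decide : Odd (47 * 2203 * 3829 : ℤ)).mul hX)
      ?_))
    · exact ((by decide : Even (4430 * 47 ^ 2 : ℤ))).mul_right _
    · exact ((by decide : Even (3 * 4430 ^ 3 * 64 : ℤ)).mul_right _).mul_right _
  · obtain rfl : Y = X + 1024 * w * y := by linear_combination hy
    obtain rfl : Z = X + 1024 * w * z := by linear_combination hz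
    ring

/-! ### Nothing cancels -/

/-- If `a` and `b` agree with `a₀` and `b₀` modulo `n` up to a common unit factor, then
`|a| = |b|` forces `a₀ = ± b₀` modulo `n`. -/
theorem dvd_sub_or_dvd_add_of_abs_eq_abs {n c a b a₀ b₀ : ℤ} (hc : IsCoprime n c)
    (ha : a ≡ c * a₀ [ZMOD n]) (hb : b ≡ c * b₀ [ZMOD n]) (h : |a| = |b|) :
    n ∣ a₀ - b₀ ∨ n ∣ a₀ + b₀ := by
  rcases abs_eq_abs.mp h with rfl | rfl
  · refine .inl (hc.dvd_of_dvd_mul_left ?_)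
    rw [mul_sub]
    exact (hb.symm.trans ha).dvd
  · refine .inr (hc.dvd_of_dvd_mul_left ?_)
    have := (ha.add hb).dvd
    rwa [neg_add_cancel, sub_zero, ← mul_add] at this

/-! ### Removing the common factor -/

/-- Dividing a nontrivial solution by the greatest common divisor of its entries. -/
theorem exists_primitive {A B : Fin 6 → ℤ} (h : IsEighthPowerSolution A B)
    (hne : IsNontrivialPair A B) : ∃ p : (Fin 6 → ℤ) × (Fin 6 → ℤ), ∃ g : ℤ,
    (IsEighthPowerSolution p.1 p.2 ∧ IsNontrivialPair p.1 p.2 ∧ IsPrimitivePair p.1 p.2) ∧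
    ∀ i, A i = g * p.1 i := by
  obtain ⟨hA, hB, hsum⟩ := h
  set g : ℤ := gcd (Finset.univ.gcd A) (Finset.univ.gcd B) with hg
  have hgA (i : Fin 6) : g ∣ A i := (gcd_dvd_left _ _).trans (Finset.gcd_dvd (Finset.mem_univ i))
  have hgB (i : Fin 6) : g ∣ B i := (gcd_dvd_right _ _).trans (Finset.gcd_dvd (Finset.mem_univ i))
  have hg0 : g ≠ 0 := fun h0 => (hA 0).ne' (zero_dvd_iff.mp (h0 ▸ hgA 0))
  have hgpos : 0 < g := by
    refine lt_of_le_of_ne ?_ hg0.symm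
    rw [hg, ← Int.coe_gcd]
    positivity
  choose a ha using hgA
  choose b hb using hgB
  refine ⟨(a, b), g, ⟨⟨fun i => ?_, fun i => ?_, ?_⟩, fun i j hij => hne i j ?_,
    fun d hda hdb => ?_⟩, ha⟩
  · exact pos_of_mul_pos_right (ha i ▸ hA i) hgpos.le
  · exact pos_of_mul_pos_right (hb i ▸ hB i) hgpos.le
  · simp only [ha, hb, mul_pow, ← Finset.mul_sum] at hsum
    exact mul_left_cancel₀ (pow_ne_zero 8 hg0) hsum
  · rw [ha, hb]; exact congrArg _ hij
  · have : g * d ∣ g := dvd_gcd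
      (Finset.dvd_gcd fun i _ => ha i ▸ mul_dvd_mul_left g (hda i))
      (Finset.dvd_gcd fun i _ => hb i ▸ mul_dvd_mul_left g (hdb i))
    exact isUnit_of_dvd_one ((mul_dvd_mul_iff_left hg0).mp (by simpa using this))

/-- A primitive solution for each `n`, whose first two entries are `|8 * t|` and `|2 * s|` up to the
common factor `g`. -/
theorem exists_solution (n : ℕ) : ∃ s t d g : ℤ, ∃ p : (Fin 6 → ℤ) × (Fin 6 → ℤ),
    (IsEighthPowerSolution p.1 p.2 ∧ IsNontrivialPair p.1 p.2 ∧ IsPrimitivePair p.1 p.2) ∧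
    |8 * t| = g * p.1 0 ∧ |2 * s| = g * p.1 1 ∧ Odd t ∧ Odd d ∧
    s * 47 - 4430 * t = 2 ^ (n + 10) * d := by
  obtain ⟨s, k, m, t, c, d, hk, hm, hc, hs', hk', hm', ht', hd, hst⟩ := exists_torsor_point n
  have hcop : IsCoprime (256 : ℤ) c := by
    have : IsCoprime ((2 : ℤ) ^ 8) c := (Int.isCoprime_two_left.mpr hc).pow_left
    norm_num at this
    exact this
  have hL (i : Fin 6) := leftForms_modEq hs' hk' hm' ht' i
  have hR (i : Fin 6) := rightForms_modEq hs' hk' hm' ht' i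
  -- for the fixed point, all these terms, differences and sums have `2`-adic valuation at most `7`
  have key : ∀ i j : Fin 6,
      ¬ (256 : ℤ) ∣ leftForms 4430 4406 7658 47 i ∧ ¬ (256 : ℤ) ∣ rightForms 4430 4406 7658 47 j ∧
      ¬ (256 : ℤ) ∣ leftForms 4430 4406 7658 47 i - rightForms 4430 4406 7658 47 j ∧
      ¬ (256 : ℤ) ∣ leftForms 4430 4406 7658 47 i + rightForms 4430 4406 7658 47 j := by
    decide
  have hL0 (i : Fin 6) : leftForms s k m t i ≠ 0 := fun h0 => (key i 0).1 <| by
    simpa using dvd_sub_or_dvd_add_of_abs_eq_abs hcop (hL i) (b := 0) (b₀ := 0)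
      (by simp) (by simp [h0])
  have hR0 (i : Fin 6) : rightForms s k m t i ≠ 0 := fun h0 => (key 0 i).2.1 <| by
    simpa using dvd_sub_or_dvd_add_of_abs_eq_abs hcop (hR i) (b := 0) (b₀ := 0)
      (by simp) (by simp [h0])
  have hto : Odd t := by
    have h2 : t ≡ c * 47 [ZMOD 2] := ht'.of_dvd (by decide)
    exact Int.odd_iff.mpr (Eq.trans h2 (Int.odd_iff.mp (hc.mul (by decide : Odd (47 : ℤ)))))
  obtain ⟨p, g, hp, hpg⟩ := exists_primitive
    (A := fun i => |leftForms s k m t i|) (B := fun i => |rightForms s k m t i|)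
    ⟨fun i => abs_pos.mpr (hL0 i), fun i => abs_pos.mpr (hR0 i), by
      simpa only [(by decide : Even 8).pow_abs] using sum_leftForms_pow_eight hk hm⟩
    (fun i j hij => (dvd_sub_or_dvd_add_of_abs_eq_abs hcop (hL i) (hR j) hij).elim
      (key i j).2.2.1 (key i j).2.2.2)
  exact ⟨s, t, d, g, p, hp, hpg 0, hpg 1, hto, hd, hst⟩

theorem eq_of_two_pow_mul_odd_eq {a b : ℕ} {u v : ℤ} (hu : Odd u) (hv : Odd v)
    (h : 2 ^ a * u = 2 ^ b * v) : a = b := by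
  have aux {a b : ℕ} {u v : ℤ} (hu : Odd u) (h : 2 ^ a * u = 2 ^ b * v) : b ≤ a := by
    by_contra! hlt
    obtain ⟨e, rfl⟩ := Nat.exists_eq_add_of_lt hlt
    have : u = 2 * (2 ^ e * v) :=
      mul_left_cancel₀ (pow_ne_zero a two_ne_zero) (h.trans (by ring))
    exact Int.not_even_iff_odd.mpr hu (this ▸ even_two_mul _)
  exact le_antisymm (aux hv h.symm) (aux hu h)

/-- Two points with the same ratio `|s / t|` belong to the same index, because the `2`-adic distance
of `s / t` from `4430 / 47` is `2 ^ (-(n + 10))`. -/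
theorem eq_of_ratio_eq {n n' : ℕ} {s t d s' t' d' : ℤ} (ht : Odd t) (hd : Odd d)
    (h : s * 47 - 4430 * t = 2 ^ (n + 10) * d) (ht' : Odd t') (hd' : Odd d')
    (h' : s' * 47 - 4430 * t' = 2 ^ (n' + 10) * d') (hr : |s * t'| = |s' * t|) : n = n' := by
  rcases abs_eq_abs.mp hr with hr | hr
  · have : 2 ^ (n + 10) * (d * t') = 2 ^ (n' + 10) * (d' * t) := by
      linear_combination 47 * hr - t' * h + t * h'
    exact Nat.add_right_cancel (eq_of_two_pow_mul_odd_eq (hd.mul ht') (hd'.mul ht) this)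
  · -- both ratios are close to `4430 / 47`, so they cannot be opposite
    obtain ⟨r, hr'⟩ := ht.mul ht'
    have : 1024 * (2 ^ n * d * t' + 2 ^ n' * d' * t) = -8860 * (2 * r + 1) := by
      rw [← hr']
      linear_combination 47 * hr - t' * h - t * h'
    lia

theorem mainTheorem2 :
    {p : (Fin 6 → ℤ) × (Fin 6 → ℤ) |
      IsEighthPowerSolution p.1 p.2 ∧ IsNontrivialPair p.1 p.2 ∧
        IsPrimitivePair p.1 p.2}.Infinite := by
  choose s t d g p hp h0 h1 ht hd hst using exists_solution
  refine Set.infinite_of_injective_forall_mem (f := p) (fun n n' hn => ?_) hp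
  refine eq_of_ratio_eq (ht n) (hd n) (hst n) (ht n') (hd n') (hst n') ?_
  have e := h0 n'
  have e' := h1 n'
  rw [← hn] at e e'
  have : |2 * s n| * |8 * t n'| = |2 * s n'| * |8 * t n| := by
    rw [h0 n, h1 n, e, e']; ring
  simp only [abs_mul, Nat.abs_ofNat] at this ⊢
  linarith
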